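/- Let $n\ge 1$. For $f\in\mathcal S(\mathbb R^{2n})$, written $f(x,u)$ with $x,u\in\mathbb R^n$, let $$Pf(\alpha,\bar x)=|\alpha|^{-n}\int_{\mathbb R^n} f\big(\tfrac1\alpha\bar x+(1-\tfrac1\alpha)u,\,u\big)\,du\quad(\alpha\ne 0),\qquad Pf(0,\bar x)=\int_{\mathbb R^n} f(x,\bar x)\,dx ,$$ and $P^*g(x,u)=\int_{\mathbb R} g(\alpha,\alpha x+(1-\alpha)u)\,d\alpha$. Let $\Omega$ be the set of $(x,u)\in\mathbb R^{2n}$ with $(x_i,u_i)\neq(0,0)$ for all $i$, let $\phi_i=\arg(x_i,u_i)\in[0,2\pi)$, and fix $j\in\{1,\dots,n\}$. (a) The product $\prod_{i\ne j}\delta(\sin(\phi_j-\phi_i))$ (equal to $1$ if $n=1$) is a well-defined measure on $\Omega$: there is exactly one Borel measure $\delta_j$ on $\mathbb R^{2n}$, carried by $\Omega$ and finite on compact subsets of $\Omega$, such that $$\int \varphi\,d\delta_j=\lim_{\varepsilon\to0^+}\int_{\mathbb R^{2n}}\varepsilon^{-(n-1)}\rho\Big(\tfrac1\varepsilon\big(\sin(\phi_j-\phi_i)\big)_{i\ne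 j}\Big)\varphi(x,u)\,dx\,du$$ for all continuous $\varphi$ with compact support contained in $\Omega$ and all continuous compactly supported $\rho$ on $\mathbb R^{n-1}$ with $\int\rho=1$. (b) The normal operator is convolution with the kernel $$K_j=\frac{|x_j-u_j|^{n-2}\prod_{i\neq j}\delta(\sin(\phi_j-\phi_i))}{\|(x_j,u_j)\|^{n-1}\prod_{i\ne j}\|(x_i,u_i)\|},$$ where $K_j$ is the measure whose density with respect to $\delta_j$ is the remaining factor and $(K_j*f)(z)=\int f(z-y)\,dK_j(y)$. That is, for every $f\in\mathcal S(\mathbb R^{2n})$ (complex-valued) and $z\in\mathbb R^{2n}$: - $P^*P|f|(z)=(K_j*|f|)(z)$ as elements of $[0,\infty]$; - whenever this value is finite, the integral defining $P^*Pf(z)$ converges absolutely and $P^*Pf(z)=(K_j*f)(z)$; - if $n\ge2$, it is finite for all $f$ and $z$, so $P^*Pf=K_j*f$ everywhere on $\mathbb R^{2n}$. (c) For $n=1$ this reads $P^*Pf=|x_1-u_1|^{-1}*f$ (convolution of functions on $\mathbb R^2$), in the same sense: $P^*P|f|(z)=(|x_1-u_1|^{-1}*|f|)(z)$ in $[0,\infty]$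 for all $f$ and $z$, and $P^*Pf(z)=(|x_1-u_1|^{-1}*f)(z)$, with both integrals absolutely convergent, whenever that value is finite. -/

import Mathlib

open MeasureTheory Filter Topology
open scoped Convolution SchwartzMap

/-- The `n`-dimensional photography transform.  For `α ≠ 0` it is
`Pf(α, x̄) = |α|⁻ⁿ ∫ f(x̄/α + (1 - 1/α) u, u) du`; at `α = 0` it is extended by the coupled Radon
transform, `Pf(0, x̄) = ∫∫ f(x, u) δ(u - x̄) dx du = ∫ f(x, x̄) dx`.
A point of `ℝⁿ × ℝⁿ` is a pair `(x, u)`; the measure is Lebesgue measure. -/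
noncomputable def photographyTransform {n : ℕ} {V : Type*} [NormedAddCommGroup V]
    [NormedSpace ℝ V] (f : (Fin n → ℝ) × (Fin n → ℝ) → V) (α : ℝ) (xbar : Fin n → ℝ) : V :=
  if α = 0 then ∫ x : Fin n → ℝ, f (x, xbar)
  else (|α| ^ n)⁻¹ • ∫ u : Fin n → ℝ, f (α⁻¹ • xbar + (1 - α⁻¹) • u, u)

/-- The dual operator `P* g(x, u) = ∫ g(α, α x + (1 - α) u) dα`. -/
noncomputable def dualPhotographyTransform {n : ℕ} {V : Type*} [NormedAddCommGroup V]
    [NormedSpace ℝ V] (g : ℝ → (Fin n → ℝ) → V) (z : (Fin n → ℝ) × (Fin n → ℝ)) : V :=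
  ∫ α : ℝ, g α (α • z.1 + (1 - α) • z.2)

/-- The principal argument in `[0, 2π)` of a point `(a, b)` of the plane. -/
noncomputable def principalArg (a b : ℝ) : ℝ :=
  toIcoMod Real.two_pi_pos 0 (Complex.arg ⟨a, b⟩)

/-- The Euclidean norm `‖(xᵢ, uᵢ)‖` of the `i`-th pair of coordinates. -/
noncomputable def pairNorm {n : ℕ} (y : (Fin n → ℝ) × (Fin n → ℝ)) (i : Fin n) : ℝ :=
  Real.sqrt (y.1 i ^ 2 + y.2 i ^ 2)

/-- The open set on which all the arguments `arg(xᵢ, uᵢ)` are defined. -/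
def pairsNonzero (n : ℕ) : Set ((Fin n → ℝ) × (Fin n → ℝ)) :=
  {y | ∀ i, (y.1 i, y.2 i) ≠ ((0 : ℝ), (0 : ℝ))}

/-- The map `(x, u) ↦ (sin(φⱼ - φᵢ))_{i ≠ j}` with `φᵢ = arg(xᵢ, uᵢ)`. -/
noncomputable def sinArgDiff {n : ℕ} (j : Fin n) (y : (Fin n → ℝ) × (Fin n → ℝ)) :
    {i : Fin n // i ≠ j} → ℝ :=
  fun i => Real.sin (principalArg (y.1 j) (y.2 j) - principalArg (y.1 i) (y.2 i))

/-- The function part of the convolution kernel,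
`|xⱼ - uⱼ|ⁿ⁻² / (‖(xⱼ, uⱼ)‖ⁿ⁻¹ ∏_{i ≠ j} ‖(xᵢ, uᵢ)‖)`. -/
noncomputable def kernelWeight {n : ℕ} (j : Fin n) (y : (Fin n → ℝ) × (Fin n → ℝ)) : ℝ :=
  |y.1 j - y.2 j| ^ ((n : ℤ) - 2) /
    (pairNorm y j ^ (n - 1) * ∏ i ∈ Finset.univ.erase j, pairNorm y i)

/-- `μ` is the composed delta function `∏ᵢ δ(gᵢ) = δ ∘ g` of a map `g` into `ℝ^ι` on the open set
`Ω`: a measure carried by `Ω`, finite on the compact subsets of `Ω`, which is the weak limit on `Ω`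
of `ε^{-|ι|} ρ(g(·)/ε)` as `ε → 0+`, for every continuous compactly supported `ρ` on `ℝ^ι` with
integral one (so `ε^{-|ι|} ρ(·/ε)` tends to `δ`).  If `ι` is empty, this is Lebesgue measure
on `Ω`. -/
structure IsDeltaComp {X ι : Type*} [TopologicalSpace X] [MeasureSpace X] [Fintype ι]
    (Ω : Set X) (g : X → ι → ℝ) (μ : Measure X) : Prop where
  compl_null : μ Ωᶜ = 0
  finite_on_compacts : ∀ K : Set X, IsCompact K → K ⊆ Ω → μ K < ⊤
  tendsto : ∀ ρ : (ι → ℝ) → ℝ, Continuous ρ → HasCompactSupport ρ → ∫ t, ρ t = 1 →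
    ∀ φ : X → ℝ, Continuous φ → HasCompactSupport φ → tsupport φ ⊆ Ω →
      Tendsto (fun ε : ℝ => ∫ y, ((ε ^ Fintype.card ι)⁻¹ * ρ (ε⁻¹ • g y)) * φ y)
        (𝓝[>] 0) (𝓝 (∫ y, φ y ∂μ))

/-! Both halves rest on coordinates that make the sines trivial. Write p for the j-th pair and give
every other pair its coordinates (tᵢ, sᵢ) in the orthonormal frame (p, p^⊥)/‖p‖. For p ≠ 0 this is a
linear isometry in each plane, so Lebesgue measure becomes dp dt ds (`measurePreserving_pairFrame`),
and sin(φⱼ - φᵢ) = sᵢ / √(tᵢ² + sᵢ²). The substitution sᵢ = ε|tᵢ|σᵢ has Jacobian ε^{n-1} ∏|tᵢ| and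
turns the sine into εσᵢ / √(1 + ε²σᵢ²) (`map_pairFrame_scaled`, `sinArgDiff_pairFrame`). The powers
of ε cancel, and dominated convergence as ε → 0 gives the limit ∫ρ · ∫ φ ∏|tᵢ| dp dt on s = 0. This
is integration against `deltaMeasure`. Uniqueness holds because measures finite on compact sets of
the open set Ω are determined there by continuous compactly supported functions.

For the operator, putting u = z₂ - w in P at the point αz₁ + (1 - α)z₂ gives P*Pf(z) = ∫∫ |α|⁻ⁿ f(z
- ((1 - 1/α)w, w)) dw dα, a convolution with `normalMeasure`. It remains to see that this measure is
the kernel times `deltaMeasure` (`withDensity_kernelWeight_deltaMeasure`). Both are the image of |p₁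
- p₂|^{n-2} dp dτ under `coneFrame`: on the delta side put t = ‖p‖τ, which absorbs the norms in the
kernel; on the other put wⱼ = b, wᵢ = bτᵢ and a = (1 - 1/α)b, so that a - b = -b/α and da = |b| α⁻²
dα.

For n ≥ 2 the convolution converges because the inner integral, with its factor |α|⁻ⁿ, is O((1 +
|α|)⁻ⁿ). -/

/-- The Euclidean norm of a point of the plane `ℝ × ℝ`. -/
noncomputable def planeNorm (p : ℝ × ℝ) : ℝ := Real.sqrt (p.1 ^ 2 + p.2 ^ 2)

/-- The coordinates of `q` in the orthonormal frame `(p, p^⊥) / ‖p‖`, where `p^⊥ = (p₂, -p₁)`. -/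
noncomputable def planeReflection (p q : ℝ × ℝ) : ℝ × ℝ :=
  ((p.1 * q.1 + p.2 * q.2) / planeNorm p, (p.2 * q.1 - p.1 * q.2) / planeNorm p)

/-- The family on `Fin n` with the value `a` at `j` and the values `b` elsewhere. -/
def insertAt {n : ℕ} (j : Fin n) {β : Type*} (a : β) (b : {i : Fin n // i ≠ j} → β) : Fin n → β :=
  fun k => if h : k = j then a else b ⟨k, h⟩

/-! ### Separating the j-th coordinate from the others -/

section InsertAt

variable {n : ℕ} {j : Fin n} {β : Type*}

@[simp] theorem insertAt_self (a : β) (b : {i : Fin n // i ≠ j} → β) : insertAt j a b j = a := by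
  simp [insertAt]

@[simp] theorem insertAt_val (a : β) (b : {i : Fin n // i ≠ j} → β) (i : {i : Fin n // i ≠ j}) :
    insertAt j a b i = b i := by
  simp [insertAt, i.2]

theorem insertAt_of_eq {a : β} {b : {i : Fin n // i ≠ j} → β} {k : Fin n} (h : k = j) :
    insertAt j a b k = a := by
  simp [insertAt, h]

theorem insertAt_of_ne {a : β} {b : {i : Fin n // i ≠ j} → β} {k : Fin n} (h : k ≠ j) :
    insertAt j a b k = b ⟨k, h⟩ := by
  simp [insertAt, h]

theorem apply_insertAt {γ : Type*} (φ : β → γ) (a : β) (b : {i : Fin n // i ≠ j} → β) :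
    (fun k => φ (insertAt j a b k)) = insertAt j (φ a) fun i => φ (b i) := by
  funext k
  by_cases h : k = j
  · simp only [insertAt_of_eq h]
  · simp only [insertAt_of_ne h]

@[fun_prop] theorem Measurable.insertAt {γ : Type*} [MeasurableSpace γ] [MeasurableSpace β]
    {a : γ → β} {b : γ → {i : Fin n // i ≠ j} → β} (ha : Measurable a) (hb : Measurable b) :
    Measurable fun x => insertAt j (a x) (b x) := by
  refine measurable_pi_iff.2 fun k => ?_
  by_cases h : k = j
  · simpa only [insertAt_of_eq h] using ha
  · simp only [insertAt_of_ne h]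
    fun_prop

theorem measurePreserving_insertAt [MeasureSpace β] [SigmaFinite (volume : Measure β)] :
    MeasurePreserving (fun p : β × ({i : Fin n // i ≠ j} → β) => insertAt j p.1 p.2) := by
  let _ : Fintype {k : Fin n // k = j} := Subtype.fintype fun k => k = j
  have h1 := (volume_preserving_piEquivPiSubtypeProd (fun _ : Fin n => β) (fun k => k = j)).symm
  have h2 := (volume_preserving_piUnique fun _ : {k : Fin n // k = j} => β).symm
  have h3 : MeasurePreserving (Prod.map
      (MeasurableEquiv.piUnique fun _ : {k : Fin n // k = j} => β).symm
      (id : ({i : Fin n // ¬ i = j} → β) → _)) volume volume :=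
    h2.prod (MeasurePreserving.id volume)
  exact h1.comp h3

end InsertAt

/-! ### The orthonormal frame attached to a plane vector -/

section Reflection

theorem planeNorm_pos {p : ℝ × ℝ} (hp : p ≠ 0) : 0 < planeNorm p := by
  refine Real.sqrt_pos.2 ?_
  by_contra! h
  refine hp (Prod.ext ?_ ?_) <;> simp <;> nlinarith [sq_nonneg p.1, sq_nonneg p.2]

theorem planeNorm_sq (p : ℝ × ℝ) : planeNorm p ^ 2 = p.1 ^ 2 + p.2 ^ 2 :=
  Real.sq_sqrt (by positivity)

@[fun_prop] theorem measurable_planeNorm : Measurable planeNorm := by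
  unfold planeNorm; fun_prop

theorem planeNorm_planeReflection {p : ℝ × ℝ} (hp : p ≠ 0) (q : ℝ × ℝ) :
    planeNorm (planeReflection p q) = planeNorm q := by
  have h0 := (planeNorm_pos hp).ne'
  have h1 := planeNorm_sq p
  unfold planeNorm
  congr 1
  simp only [planeReflection, div_pow]
  rw [← add_div, div_eq_iff (pow_ne_zero _ h0), h1]
  ring

/-- With p^⊥ = (p₂, -p₁) the frame matrix is symmetric as well as orthogonal, so the passage to
frame coordinates and its inverse are the same map. -/
theorem planeReflection_involutive {p : ℝ × ℝ} (hp : p ≠ 0) (q : ℝ × ℝ) :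
    planeReflection p (planeReflection p q) = q := by
  have h0 := (planeNorm_pos hp).ne'
  have h1 := planeNorm_sq p
  ext <;> simp only [planeReflection] <;> field_simp <;> rw [h1] <;> ring

/-- An involution has determinant ±1. -/
theorem measurePreserving_planeReflection {p : ℝ × ℝ} (hp : p ≠ 0) :
    MeasurePreserving (planeReflection p) := by
  let f : (ℝ × ℝ) →ₗ[ℝ] (ℝ × ℝ) :=
    { toFun := planeReflection p
      map_add' := fun x y => by ext <;> simp [planeReflection] <;> ring
      map_smul' := fun x y => by ext <;> simp [planeReflection] <;> ring }
  have hf : f ∘ₗ f = LinearMap.id := LinearMap.ext fun q => planeReflection_involutive hp q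
  have hd : LinearMap.det f * LinearMap.det f = 1 := by
    rw [← LinearMap.det_comp, hf, LinearMap.det_id]
  have hd0 : LinearMap.det f ≠ 0 := fun h => by simp [h] at hd
  have habs : |(LinearMap.det f)⁻¹| = 1 := by
    rcases mul_self_eq_one_iff.1 hd with h | h <;> simp [h]
  refine ⟨f.continuous_of_finiteDimensional.measurable, ?_⟩
  have := Measure.map_linearMap_addHaar_eq_smul_addHaar (volume : Measure (ℝ × ℝ)) hd0
  rw [habs, ENNReal.ofReal_one, one_smul] at this
  exact this

end Reflection

/-! ### Frame coordinates (p, t, s) on ℝ²ⁿ -/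

/-- The point whose `j`-th pair of coordinates is `p`, and whose `i`-th pair is
`tᵢ p / ‖p‖ + sᵢ p^⊥ / ‖p‖` for `i ≠ j`. -/
noncomputable def pairFrame {n : ℕ} (j : Fin n) (p : ℝ × ℝ) (t s : {i : Fin n // i ≠ j} → ℝ) :
    (Fin n → ℝ) × (Fin n → ℝ) :=
  (insertAt j p.1 fun i => (planeReflection p (t i, s i)).1,
    insertAt j p.2 fun i => (planeReflection p (t i, s i)).2)

section PairFrame

variable {n : ℕ} {j : Fin n}

theorem measurable_pairFrame : Measurable
    fun w : ((ℝ × ℝ) × ({i : Fin n // i ≠ j} → ℝ)) × ({i : Fin n // i ≠ j} → ℝ) =>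
      pairFrame j w.1.1 w.1.2 w.2 := by
  unfold pairFrame
  unfold planeReflection
  fun_prop

/-- A skew product over p: for almost every p the fibre map is a product of plane reflections. The
remaining factors only regroup coordinates. -/
theorem measurePreserving_pairFrame : MeasurePreserving
    fun w : ((ℝ × ℝ) × ({i : Fin n // i ≠ j} → ℝ)) × ({i : Fin n // i ≠ j} → ℝ) =>
      pairFrame j w.1.1 w.1.2 w.2 := by
  have h1 : MeasurePreserving (MeasurableEquiv.prodAssoc :
      ((ℝ × ℝ) × ({i : Fin n // i ≠ j} → ℝ)) × ({i : Fin n // i ≠ j} → ℝ) ≃ᵐ _) :=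
    volume_preserving_prodAssoc
  have h2 := (MeasurePreserving.id (volume : Measure (ℝ × ℝ))).prod
    (volume_measurePreserving_arrowProdEquivProdArrow ℝ ℝ {i : Fin n // i ≠ j}).symm
  have h3 : MeasurePreserving fun w : (ℝ × ℝ) × ({i : Fin n // i ≠ j} → ℝ × ℝ) =>
      (w.1, fun i => planeReflection w.1 (w.2 i)) := by
    refine (MeasurePreserving.id (volume : Measure (ℝ × ℝ))).skew_product
      (g := fun (p : ℝ × ℝ) (q : {i : Fin n // i ≠ j} → ℝ × ℝ) i => planeReflection p (q i))
      ?_ ?_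
    · refine measurable_pi_iff.2 fun i => ?_
      unfold planeReflection Function.uncurry
      fun_prop
    · filter_upwards [Measure.ae_ne volume (0 : ℝ × ℝ)] with p hp
      exact (volume_preserving_pi fun _ : {i : Fin n // i ≠ j} =>
        measurePreserving_planeReflection hp).map_eq
  have h4 := measurePreserving_insertAt (j := j) (β := ℝ × ℝ)
  have h5 := volume_measurePreserving_arrowProdEquivProdArrow ℝ ℝ (Fin n)
  have h6 := h5.comp (h4.comp (h3.comp (h2.comp h1)))
  convert h6 using 1
  funext w
  exact (Prod.ext (apply_insertAt Prod.fst w.1.1 fun i => planeReflection w.1.1 (w.1.2 i, w.2 i))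
    (apply_insertAt Prod.snd w.1.1 fun i => planeReflection w.1.1 (w.1.2 i, w.2 i))).symm

theorem lintegral_eq_prod_mul_lintegral_mul {ι : Type*} [Fintype ι] {d : ι → ℝ}
    (hd : ∀ i, d i ≠ 0) {H : (ι → ℝ) → ENNReal} (hH : Measurable H) :
    ∫⁻ s, H s = ENNReal.ofReal (∏ i, |d i|) * ∫⁻ s : ι → ℝ, H fun i => d i * s i := by
  classical
  have hdet : (Matrix.diagonal d).det ≠ 0 := by
    simpa [Matrix.det_diagonal, Finset.prod_ne_zero_iff] using hd
  conv_lhs => rw [← Real.smul_map_diagonal_volume_pi hdet]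
  rw [lintegral_smul_measure, lintegral_map hH
    (LinearMap.continuous_of_finiteDimensional _).measurable, Matrix.det_diagonal,
    Finset.abs_prod, smul_eq_mul]
  congr 2
  funext s
  congr 1
  funext i
  simp [Matrix.mulVec_diagonal]

end PairFrame

theorem lintegral_map_withDensity {α β : Type*} [MeasurableSpace α] [MeasurableSpace β]
    {μ : Measure α} {g : α → ENNReal} {Φ : α → β} {h : β → ENNReal} (hg : Measurable g)
    (hΦ : Measurable Φ) (hh : Measurable h) :
    ∫⁻ y, h y ∂(μ.withDensity g).map Φ = ∫⁻ w, g w * h (Φ w) ∂μ := by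
  rw [lintegral_map hh hΦ]
  exact lintegral_withDensity_eq_lintegral_mul μ hg (hh.comp hΦ)

/-! ### The sines in frame coordinates -/

section Sine

variable {n : ℕ} {j : Fin n}

/-- The choice of branch of the argument is irrelevant, since the sine has period 2π. -/
theorem sinArgDiff_eq_sin_arg_sub (y : (Fin n → ℝ) × (Fin n → ℝ)) (i : {i : Fin n // i ≠ j}) :
    sinArgDiff j y i =
      Real.sin (Complex.arg ⟨y.1 j, y.2 j⟩ - Complex.arg ⟨y.1 i, y.2 i⟩) := by
  simp only [sinArgDiff, principalArg, toIcoMod, zsmul_eq_mul]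
  rw [show ∀ a b : ℝ, ∀ k l : ℤ, a - k * (2 * Real.pi) - (b - l * (2 * Real.pi))
    = a - b - ((k - l : ℤ) : ℝ) * (2 * Real.pi) by intros; push_cast; ring,
    Real.sin_sub_int_mul_two_pi]

theorem measurable_sinArgDiff : Measurable (sinArgDiff j) := by
  refine measurable_pi_iff.2 fun i => ?_
  simp only [sinArgDiff_eq_sin_arg_sub]
  have h : ∀ k : Fin n, Measurable fun y : (Fin n → ℝ) × (Fin n → ℝ) =>
      Complex.arg ⟨y.1 k, y.2 k⟩ := fun k => by
    refine Complex.measurable_arg.comp ?_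
    refine Complex.measurableEquivRealProd.symm.measurable.comp
      (g := Complex.measurableEquivRealProd.symm)
      (f := fun y : (Fin n → ℝ) × (Fin n → ℝ) => (y.1 k, y.2 k)) ?_
    fun_prop
  exact Real.measurable_sin.comp ((h j).sub (h i))

theorem sinArgDiff_eq_div {y : (Fin n → ℝ) × (Fin n → ℝ)} (hy : y ∈ pairsNonzero n)
    (i : {i : Fin n // i ≠ j}) :
    sinArgDiff j y i =
      (y.2 j * y.1 i - y.1 j * y.2 i) / (pairNorm y j * pairNorm y i) := by
  have h0 : ∀ k, (⟨y.1 k, y.2 k⟩ : ℂ) ≠ 0 := fun k h =>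
    hy k (Prod.ext (congrArg Complex.re h) (congrArg Complex.im h))
  have hn : ∀ k, ‖(⟨y.1 k, y.2 k⟩ : ℂ)‖ = pairNorm y k := fun k => by
    rw [Complex.norm_eq_sqrt_sq_add_sq]; rfl
  rw [sinArgDiff_eq_sin_arg_sub, Real.sin_sub, Complex.sin_arg, Complex.sin_arg,
    Complex.cos_arg (h0 _), Complex.cos_arg (h0 _), hn, hn, div_mul_div_comm, div_mul_div_comm,
    ← sub_div]

theorem isOpen_pairsNonzero (n : ℕ) : IsOpen (pairsNonzero n) := by
  simp only [pairsNonzero, Set.ofPred_forall]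
  exact isOpen_iInter_of_finite fun i => isOpen_ne_fun (by fun_prop) continuous_const

theorem pairNorm_pairFrame_self (p : ℝ × ℝ) (t s : {i : Fin n // i ≠ j} → ℝ) :
    pairNorm (pairFrame j p t s) j = planeNorm p := by
  simp [pairNorm, pairFrame, planeNorm]

theorem pairNorm_pairFrame_val {p : ℝ × ℝ} (hp : p ≠ 0) (t s : {i : Fin n // i ≠ j} → ℝ)
    (i : {i : Fin n // i ≠ j}) :
    pairNorm (pairFrame j p t s) i = Real.sqrt (t i ^ 2 + s i ^ 2) := by
  have := planeNorm_planeReflection hp (t i, s i)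
  simpa [pairNorm, pairFrame, planeNorm] using this

theorem mem_pairsNonzero_iff {y : (Fin n → ℝ) × (Fin n → ℝ)} :
    y ∈ pairsNonzero n ↔ ∀ i, 0 < pairNorm y i := by
  refine forall_congr' fun i => ?_
  constructor
  · exact fun h => planeNorm_pos (p := (y.1 i, y.2 i)) h
  · intro h h0
    simp only [Prod.mk.injEq] at h0
    simp [pairNorm, h0] at h

theorem pairNorm_le (y : (Fin n → ℝ) × (Fin n → ℝ)) (i : Fin n) : pairNorm y i ≤ 2 * ‖y‖ := by
  have h1 : |y.1 i| ≤ ‖y‖ := (norm_le_pi_norm y.1 i).trans (norm_fst_le y)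
  have h2 : |y.2 i| ≤ ‖y‖ := (norm_le_pi_norm y.2 i).trans (norm_snd_le y)
  refine Real.sqrt_le_iff.2 ⟨by positivity, ?_⟩
  have h3 := sq_le_sq' (by linarith [abs_nonneg (y.1 i), norm_nonneg y]) h1
  have h4 := sq_le_sq' (by linarith [abs_nonneg (y.2 i), norm_nonneg y]) h2
  rw [sq_abs] at h3 h4
  nlinarith [norm_nonneg y]

theorem pairFrame_mem_pairsNonzero {p : ℝ × ℝ} (hp : p ≠ 0) {t s : {i : Fin n // i ≠ j} → ℝ}
    (ht : ∀ i, t i ≠ 0) : pairFrame j p t s ∈ pairsNonzero n := by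
  refine mem_pairsNonzero_iff.2 fun k => ?_
  by_cases hk : k = j
  · subst hk
    rw [pairNorm_pairFrame_self]
    exact planeNorm_pos hp
  · have := pairNorm_pairFrame_val hp t s ⟨k, hk⟩
    rw [show pairNorm (pairFrame j p t s) k = _ from this]
    have := ht ⟨k, hk⟩
    positivity

/-- Properness of the coordinates in (p, t), uniformly in s: it confines (p, t) to a ball when the
point lies in a compact set. The constant comes from comparing the Euclidean norm of a pair with the
sup norm. -/
theorem norm_le_two_mul_norm_pairFrame {p : ℝ × ℝ} (hp : p ≠ 0)
    (t s : {i : Fin n // i ≠ j} → ℝ) : ‖(p, t)‖ ≤ 2 * ‖pairFrame j p t s‖ := by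
  have h0 := norm_nonneg (pairFrame j p t s)
  refine max_le (max_le ?_ ?_) ((pi_norm_le_iff_of_nonneg (by positivity)).2 fun i => ?_)
  · have := (norm_le_pi_norm (pairFrame j p t s).1 j).trans (norm_fst_le _)
    simp only [pairFrame, insertAt_self] at this h0 ⊢
    linarith
  · have := (norm_le_pi_norm (pairFrame j p t s).2 j).trans (norm_snd_le _)
    simp only [pairFrame, insertAt_self] at this h0 ⊢
    linarith
  · have := pairNorm_le (pairFrame j p t s) i
    rw [pairNorm_pairFrame_val hp] at this
    exact (Real.abs_le_sqrt (by nlinarith [sq_nonneg (s i)])).trans this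

/-- The sine sᵢ / √(tᵢ² + sᵢ²) is homogeneous of degree 0 in (tᵢ, sᵢ), so measuring sᵢ in units of
|tᵢ| removes tᵢ altogether. -/
theorem sinArgDiff_pairFrame {p : ℝ × ℝ} (hp : p ≠ 0) {t σ : {i : Fin n // i ≠ j} → ℝ}
    (ht : ∀ i, t i ≠ 0) (ε : ℝ) :
    sinArgDiff j (pairFrame j p t fun i => ε * |t i| * σ i) =
      ε • fun i => σ i / Real.sqrt (1 + ε ^ 2 * σ i ^ 2) := by
  funext i
  have h0 := planeNorm_pos hp
  have h1 := planeNorm_sq p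
  have h2 := abs_pos.2 (ht i)
  have h3 : Real.sqrt (t i ^ 2 + (ε * |t i| * σ i) ^ 2)
      = |t i| * Real.sqrt (1 + ε ^ 2 * σ i ^ 2) := by
    rw [← Real.sqrt_sq_eq_abs, ← Real.sqrt_mul (sq_nonneg _), Real.sqrt_sq_eq_abs]
    congr 1
    rw [mul_pow, mul_pow, sq_abs]
    ring
  have h4 : 0 < Real.sqrt (1 + ε ^ 2 * σ i ^ 2) := Real.sqrt_pos.2 (by positivity)
  rw [sinArgDiff_eq_div (pairFrame_mem_pairsNonzero hp ht), pairNorm_pairFrame_self,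
    pairNorm_pairFrame_val hp, h3]
  simp only [pairFrame, insertAt_self, insertAt_val, planeReflection, Pi.smul_apply, smul_eq_mul]
  field_simp
  rw [h1]
  ring

theorem ae_plane_prod_pi {ι : Type*} [Fintype ι] :
    ∀ᵐ w : (ℝ × ℝ) × (ι → ℝ), w.1 ≠ 0 ∧ ∀ i, w.2 i ≠ 0 := by
  have h1 : ∀ᵐ w : (ℝ × ℝ) × (ι → ℝ), w.1 ≠ 0 :=
    Measure.quasiMeasurePreserving_fst.ae (Measure.ae_ne volume (0 : ℝ × ℝ))
  have h2 : ∀ᵐ t : ι → ℝ, ∀ i, t i ≠ 0 :=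
    ae_all_iff.2 fun i => Measure.ae_eval_ne (μ := fun _ : ι => (volume : Measure ℝ)) i 0
  have h3 : ∀ᵐ w : (ℝ × ℝ) × (ι → ℝ), ∀ i, w.2 i ≠ 0 :=
    Measure.quasiMeasurePreserving_snd.ae h2
  exact h1.and h3

end Sine

/-! ### The delta measure -/

/-- The measure `∏_{i ≠ j} δ(sin(φⱼ - φᵢ))`: Lebesgue measure in the `j`-th pair `p` times
`∏ |tᵢ| dtᵢ`, carried by the points with pairs `tᵢ p / ‖p‖` for `i ≠ j`. -/
noncomputable def deltaMeasure {n : ℕ} (j : Fin n) : Measure ((Fin n → ℝ) × (Fin n → ℝ)) :=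
  ((volume : Measure ((ℝ × ℝ) × ({i : Fin n // i ≠ j} → ℝ))).withDensity
    fun w => ENNReal.ofReal (∏ i, |w.2 i|)).map fun w => pairFrame j w.1 w.2 0

section Delta

variable {n : ℕ} {j : Fin n}

theorem measurable_pairFrame_zero : Measurable
    fun w : (ℝ × ℝ) × ({i : Fin n // i ≠ j} → ℝ) => pairFrame j w.1 w.2 0 :=
  measurable_pairFrame.comp (f := fun w => (w, (0 : {i : Fin n // i ≠ j} → ℝ))) (by fun_prop)

theorem measurable_prod_abs_snd {ι : Type*} [Fintype ι] :
    Measurable fun w : (ℝ × ℝ) × (ι → ℝ) => ENNReal.ofReal (∏ i, |w.2 i|) :=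
  ENNReal.measurable_ofReal.comp
    (by fun_prop : Continuous fun w : (ℝ × ℝ) × (ι → ℝ) => ∏ i, |w.2 i|).measurable

theorem measurable_pairFrame_scaled (ε : ℝ) : Measurable
    fun w : ((ℝ × ℝ) × ({i : Fin n // i ≠ j} → ℝ)) × ({i : Fin n // i ≠ j} → ℝ) =>
      pairFrame j w.1.1 w.1.2 fun i => ε * |w.1.2 i| * w.2 i :=
  measurable_pairFrame.comp (f := fun w : ((ℝ × ℝ) × ({i : Fin n // i ≠ j} → ℝ)) ×
      ({i : Fin n // i ≠ j} → ℝ) => (w.1, fun i => ε * |w.1.2 i| * w.2 i))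
    ((by fun_prop : Continuous _).measurable)

/-- The change of variables s = ε|t|σ on each fibre with all tᵢ ≠ 0; the excluded fibres are null.
-/
theorem map_pairFrame_scaled {ε : ℝ} (hε : 0 < ε) :
    ((volume : Measure (((ℝ × ℝ) × ({i : Fin n // i ≠ j} → ℝ)) ×
      ({i : Fin n // i ≠ j} → ℝ))).withDensity fun w => ENNReal.ofReal
        (ε ^ Fintype.card {i : Fin n // i ≠ j} * ∏ i, |w.1.2 i|)).map
      (fun w => pairFrame j w.1.1 w.1.2 fun i => ε * |w.1.2 i| * w.2 i) = volume := by
  have hd : Measurable fun w : ((ℝ × ℝ) × ({i : Fin n // i ≠ j} → ℝ)) ×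
      ({i : Fin n // i ≠ j} → ℝ) => ENNReal.ofReal
        (ε ^ Fintype.card {i : Fin n // i ≠ j} * ∏ i, |w.1.2 i|) :=
    ENNReal.measurable_ofReal.comp (by fun_prop : Continuous _).measurable
  refine Measure.ext_of_lintegral _ fun h hh => ?_
  have hm : Measurable fun w : ((ℝ × ℝ) × ({i : Fin n // i ≠ j} → ℝ)) ×
      ({i : Fin n // i ≠ j} → ℝ) => ENNReal.ofReal
        (ε ^ Fintype.card {i : Fin n // i ≠ j} * ∏ i, |w.1.2 i|) *
        h (pairFrame j w.1.1 w.1.2 fun i => ε * |w.1.2 i| * w.2 i) :=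
    hd.mul (hh.comp (measurable_pairFrame_scaled ε))
  have hm' : Measurable fun w : ((ℝ × ℝ) × ({i : Fin n // i ≠ j} → ℝ)) ×
      ({i : Fin n // i ≠ j} → ℝ) => h (pairFrame j w.1.1 w.1.2 w.2) :=
    hh.comp measurable_pairFrame
  rw [lintegral_map_withDensity hd (measurable_pairFrame_scaled ε) hh,
    ← (measurePreserving_pairFrame (j := j)).lintegral_comp hh,
    Measure.volume_eq_prod ((ℝ × ℝ) × ({i : Fin n // i ≠ j} → ℝ)),
    lintegral_prod _ hm.aemeasurable, lintegral_prod _ hm'.aemeasurable]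
  refine lintegral_congr_ae ?_
  filter_upwards [ae_plane_prod_pi] with w hw
  rw [lintegral_eq_prod_mul_lintegral_mul (H := fun s => h (pairFrame j w.1 w.2 s))
    (d := fun i => ε * |w.2 i|) (fun i => mul_ne_zero hε.ne' (abs_ne_zero.2 (hw.2 i)))
    (hm'.comp measurable_prodMk_left), lintegral_const_mul]
  · simp only [abs_mul, abs_abs, Finset.prod_mul_distrib, abs_of_pos hε, Finset.prod_const,
      Finset.card_univ]
  · exact hh.comp ((measurable_pairFrame_scaled ε).comp measurable_prodMk_left)

theorem lintegral_deltaMeasure {h : (Fin n → ℝ) × (Fin n → ℝ) → ENNReal} (hh : Measurable h) :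
    ∫⁻ y, h y ∂deltaMeasure j = ∫⁻ w : (ℝ × ℝ) × ({i : Fin n // i ≠ j} → ℝ),
      ENNReal.ofReal (∏ i, |w.2 i|) * h (pairFrame j w.1 w.2 0) :=
  lintegral_map_withDensity measurable_prod_abs_snd measurable_pairFrame_zero hh

theorem integral_deltaMeasure {φ : (Fin n → ℝ) × (Fin n → ℝ) → ℝ} (hφ : Measurable φ) :
    ∫ y, φ y ∂deltaMeasure j = ∫ w : (ℝ × ℝ) × ({i : Fin n // i ≠ j} → ℝ),
      (∏ i, |w.2 i|) * φ (pairFrame j w.1 w.2 0) := by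
  rw [deltaMeasure, integral_map measurable_pairFrame_zero.aemeasurable
    hφ.aestronglyMeasurable, integral_withDensity_eq_integral_toReal_smul measurable_prod_abs_snd
      (by simp)]
  refine integral_congr_ae (.of_forall fun w => ?_)
  simp only [smul_eq_mul]
  rw [ENNReal.toReal_ofReal (by positivity)]

theorem deltaMeasure_compl_pairsNonzero : deltaMeasure j (pairsNonzero n)ᶜ = 0 := by
  rw [deltaMeasure, Measure.map_apply measurable_pairFrame_zero
    (isOpen_pairsNonzero n).measurableSet.compl]
  refine withDensity_absolutelyContinuous _ _ ?_
  refine measure_mono_null ?_ (ae_iff.1 ae_plane_prod_pi)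
  intro w hw hw'
  exact hw (pairFrame_mem_pairsNonzero hw'.1 hw'.2)

theorem deltaMeasure_lt_top_of_isCompact {K : Set ((Fin n → ℝ) × (Fin n → ℝ))} (hK : IsCompact K) :
    deltaMeasure j K < ⊤ := by
  obtain ⟨M, hM⟩ := hK.isBounded.exists_norm_le
  rw [deltaMeasure, Measure.map_apply measurable_pairFrame_zero hK.measurableSet]
  have hfin : IsLocallyFiniteMeasure
      ((volume : Measure ((ℝ × ℝ) × ({i : Fin n // i ≠ j} → ℝ))).withDensity
        fun w => ENNReal.ofReal (∏ i, |w.2 i|)) :=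
    IsLocallyFiniteMeasure.withDensity_ofReal (by fun_prop)
  refine (measure_mono_ae ?_).trans_lt
    (isCompact_closedBall (0 : (ℝ × ℝ) × ({i : Fin n // i ≠ j} → ℝ)) (2 * M)).measure_lt_top
  filter_upwards [(withDensity_absolutelyContinuous _ _).ae_le ae_plane_prod_pi] with w hw hwK
  refine mem_closedBall_zero_iff.2 ((norm_le_two_mul_norm_pairFrame hw.1 w.2 0).trans ?_)
  exact mul_le_mul_of_nonneg_left (hM _ hwK) zero_le_two

end Delta

/-! ### The weak limit as ε → 0 -/

section Limit

variable {n : ℕ} {j : Fin n}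

theorem integral_sinArgDiff_rescaled {ρ : ({i : Fin n // i ≠ j} → ℝ) → ℝ} (hρ : Continuous ρ)
    {φ : (Fin n → ℝ) × (Fin n → ℝ) → ℝ} (hφ : Continuous φ) {ε : ℝ} (hε : 0 < ε) :
    ∫ y, ((ε ^ Fintype.card {i : Fin n // i ≠ j})⁻¹ * ρ (ε⁻¹ • sinArgDiff j y)) * φ y =
      ∫ w : ((ℝ × ℝ) × ({i : Fin n // i ≠ j} → ℝ)) × ({i : Fin n // i ≠ j} → ℝ),
        (∏ i, |w.1.2 i|) * (ρ (fun i => w.2 i / Real.sqrt (1 + ε ^ 2 * w.2 i ^ 2)) *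
          φ (pairFrame j w.1.1 w.1.2 fun i => ε * |w.1.2 i| * w.2 i)) := by
  have hd : Measurable fun w : ((ℝ × ℝ) × ({i : Fin n // i ≠ j} → ℝ)) ×
      ({i : Fin n // i ≠ j} → ℝ) => ENNReal.ofReal
        (ε ^ Fintype.card {i : Fin n // i ≠ j} * ∏ i, |w.1.2 i|) :=
    ENNReal.measurable_ofReal.comp (by fun_prop : Continuous _).measurable
  have hF : Measurable fun y =>
      ((ε ^ Fintype.card {i : Fin n // i ≠ j})⁻¹ * ρ (ε⁻¹ • sinArgDiff j y)) * φ y :=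
    (measurable_const.mul (hρ.measurable.comp (measurable_sinArgDiff.const_smul ε⁻¹))).mul
      hφ.measurable
  conv_lhs => rw [← map_pairFrame_scaled (j := j) hε]
  rw [integral_map (measurable_pairFrame_scaled ε).aemeasurable hF.aestronglyMeasurable,
    integral_withDensity_eq_integral_toReal_smul hd (by simp)]
  refine integral_congr_ae ?_
  have hae : ∀ᵐ w : ((ℝ × ℝ) × ({i : Fin n // i ≠ j} → ℝ)) × ({i : Fin n // i ≠ j} → ℝ),
      w.1.1 ≠ 0 ∧ ∀ i, w.1.2 i ≠ 0 :=
    Measure.quasiMeasurePreserving_fst.ae ae_plane_prod_pi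
  filter_upwards [hae] with w hw
  have hεm := pow_ne_zero (Fintype.card {i : Fin n // i ≠ j}) hε.ne'
  rw [ENNReal.toReal_ofReal (by positivity), sinArgDiff_pairFrame hw.1 hw.2, smul_smul,
    inv_mul_cancel₀ hε.ne', one_smul, smul_eq_mul]
  generalize ρ _ = a, φ _ = b
  field_simp

/-- Squaring gives x² ≤ R² + (εR)²x² ≤ R² + x²/4. This keeps σ bounded uniformly in small ε although
x / √(1 + ε²x²) flattens at infinity. -/
theorem abs_le_two_mul_of_div_sqrt_le {x ε R : ℝ} (hε : 0 ≤ ε) (hR : ε * R ≤ 1 / 2)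
    (h : |x / Real.sqrt (1 + ε ^ 2 * x ^ 2)| ≤ R) : |x| ≤ 2 * R := by
  have hR0 : 0 ≤ R := (abs_nonneg _).trans h
  have h1 : 0 < Real.sqrt (1 + ε ^ 2 * x ^ 2) := Real.sqrt_pos.2 (by positivity)
  rw [abs_div, abs_of_pos h1, div_le_iff₀ h1] at h
  have h2 := mul_self_le_mul_self (abs_nonneg x) h
  rw [abs_mul_abs_self, mul_mul_mul_comm, Real.mul_self_sqrt (by positivity)] at h2
  have h3 : (ε * R) ^ 2 ≤ (1 / 2) ^ 2 := pow_le_pow_left₀ (by positivity) hR 2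
  have h4 := mul_le_mul_of_nonneg_right h3 (sq_nonneg x)
  exact abs_le_of_sq_le_sq (by nlinarith) (by positivity)

theorem tendsto_integral_sinArgDiff_rescaled {ρ : ({i : Fin n // i ≠ j} → ℝ) → ℝ}
    (hρ : Continuous ρ) (hρc : HasCompactSupport ρ) {φ : (Fin n → ℝ) × (Fin n → ℝ) → ℝ}
    (hφ : Continuous φ) (hφc : HasCompactSupport φ) :
    Tendsto (fun ε : ℝ => ∫ y, ((ε ^ Fintype.card {i : Fin n // i ≠ j})⁻¹ *
      ρ (ε⁻¹ • sinArgDiff j y)) * φ y) (𝓝[>] 0) (𝓝 ((∫ y, φ y ∂deltaMeasure j) * ∫ t, ρ t)) := by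
  have hlim : (∫ y, φ y ∂deltaMeasure j) * ∫ t, ρ t =
      ∫ w : ((ℝ × ℝ) × ({i : Fin n // i ≠ j} → ℝ)) × ({i : Fin n // i ≠ j} → ℝ),
        (∏ i, |w.1.2 i|) * (ρ w.2 * φ (pairFrame j w.1.1 w.1.2 0)) := by
    rw [integral_deltaMeasure hφ.measurable, ← integral_prod_mul]
    refine integral_congr_ae (.of_forall fun w => ?_)
    simp only
    ring
  rw [hlim]
  obtain ⟨M, hM⟩ := hφc.isCompact.isBounded.exists_norm_le
  obtain ⟨R, hR⟩ := hρc.isCompact.isBounded.exists_norm_le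
  obtain ⟨A, hA⟩ := hρ.bounded_above_of_compact_support hρc
  obtain ⟨B, hB⟩ := hφ.bounded_above_of_compact_support hφc
  -- The supports of φ and ρ bound (p, t) by 2|M| and σ by 2|R|. The absolute values cover empty
  -- supports, where M and R may be negative.
  set N : ℝ := max (2 * |M|) (2 * |R|)
  have hN : 0 ≤ N := le_max_of_le_left (by positivity)
  have hcongr : (fun ε : ℝ => ∫ y, ((ε ^ Fintype.card {i : Fin n // i ≠ j})⁻¹ *
      ρ (ε⁻¹ • sinArgDiff j y)) * φ y) =ᶠ[𝓝[>] 0] fun ε =>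
      ∫ w : ((ℝ × ℝ) × ({i : Fin n // i ≠ j} → ℝ)) × ({i : Fin n // i ≠ j} → ℝ),
        (∏ i, |w.1.2 i|) * (ρ (fun i => w.2 i / Real.sqrt (1 + ε ^ 2 * w.2 i ^ 2)) *
          φ (pairFrame j w.1.1 w.1.2 fun i => ε * |w.1.2 i| * w.2 i)) := by
    filter_upwards [self_mem_nhdsWithin] with ε hε
    exact integral_sinArgDiff_rescaled hρ hφ hε
  refine Tendsto.congr' hcongr.symm ?_
  refine tendsto_integral_filter_of_dominated_convergence
    ((Metric.closedBall 0 N).indicator fun _ =>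
      N ^ Fintype.card {i : Fin n // i ≠ j} * (A * B)) ?_ ?_ ?_ ?_
  · refine .of_forall fun ε => Measurable.aestronglyMeasurable ?_
    refine Measurable.mul (by fun_prop) (Measurable.mul ?_ ?_)
    · exact hρ.measurable.comp (by fun_prop)
    · exact hφ.measurable.comp (measurable_pairFrame_scaled ε)
  -- This threshold forces ε|R| ≤ 1/2, as the bound on σ requires.
  · have hε0 : (0 : ℝ) < 1 / (2 * (|R| + 1)) := by positivity
    filter_upwards [Ioo_mem_nhdsGT hε0] with ε hε
    have hεR : ε * |R| ≤ 1 / 2 := by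
      have := (lt_div_iff₀ (by positivity)).1 hε.2
      nlinarith [hε.1]
    have hae : ∀ᵐ w : ((ℝ × ℝ) × ({i : Fin n // i ≠ j} → ℝ)) × ({i : Fin n // i ≠ j} → ℝ),
        w.1.1 ≠ 0 ∧ ∀ i, w.1.2 i ≠ 0 :=
      Measure.quasiMeasurePreserving_fst.ae ae_plane_prod_pi
    filter_upwards [hae] with w hw
    by_cases hwN : w ∈ Metric.closedBall 0 N
    · rw [Set.indicator_of_mem hwN, norm_mul, norm_mul]
      have hwN' := mem_closedBall_zero_iff.1 hwN
      refine mul_le_mul ?_ (mul_le_mul (hA _) (hB _) (norm_nonneg _)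
        ((norm_nonneg _).trans (hA 0))) (by positivity) (by positivity)
      rw [Real.norm_of_nonneg (by positivity)]
      refine (Finset.prod_le_prod (g := fun _ => N) (fun _ _ => abs_nonneg _) fun i _ => ?_).trans_eq
        (by rw [Finset.prod_const, Finset.card_univ])
      exact (norm_le_pi_norm w.1.2 i).trans ((norm_snd_le _).trans ((norm_fst_le _).trans hwN'))
    · rw [Set.indicator_of_notMem hwN]
      refine le_of_eq (norm_eq_zero.2 ?_)
      by_contra hne
      have hρ0 := left_ne_zero_of_mul (right_ne_zero_of_mul hne)
      have hφ0 := right_ne_zero_of_mul (right_ne_zero_of_mul hne)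
      have h1 := hM _ (subset_tsupport _ hφ0)
      have h2 := hR _ (subset_tsupport _ hρ0)
      refine hwN (mem_closedBall_zero_iff.2 (max_le ?_ ?_))
      · refine (norm_le_two_mul_norm_pairFrame hw.1 w.1.2
          fun i => ε * |w.1.2 i| * w.2 i).trans (le_max_of_le_left ?_)
        exact mul_le_mul_of_nonneg_left (h1.trans (le_abs_self M)) zero_le_two
      · refine (pi_norm_le_iff_of_nonneg hN).2 fun i => le_max_of_le_right ?_
        refine abs_le_two_mul_of_div_sqrt_le hε.1.le hεR ?_
        exact (norm_le_pi_norm _ i).trans (h2.trans (le_abs_self R))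
  · exact (integrable_indicator_iff Metric.isClosed_closedBall.measurableSet).2
      (integrableOn_const (isCompact_closedBall _ _).measure_lt_top.ne)
  · refine .of_forall fun w => ?_
    refine Tendsto.mono_left ?_ nhdsWithin_le_nhds
    refine Tendsto.const_mul _ (Tendsto.mul ?_ ?_)
    · have h : Continuous fun ε : ℝ => ρ fun i => w.2 i / Real.sqrt (1 + ε ^ 2 * w.2 i ^ 2) := by
        refine hρ.comp (continuous_pi fun i => continuous_const.div (by fun_prop) fun ε => ?_)
        exact (Real.sqrt_pos.2 (by positivity)).ne'
      simpa using h.tendsto 0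
    · have h : Continuous fun s => pairFrame j w.1.1 w.1.2 s := by
        refine Continuous.prodMk ?_ ?_ <;> refine continuous_pi fun k => ?_ <;>
          by_cases hk : k = j <;> simp only [insertAt, hk, dite_true, dite_false, planeReflection] <;>
          fun_prop
      have h' : Continuous fun ε : ℝ => φ (pairFrame j w.1.1 w.1.2 fun i =>
          ε * |w.1.2 i| * w.2 i) := hφ.comp (h.comp (by fun_prop))
      have := h'.tendsto 0
      simp only [zero_mul] at this
      exact this

theorem isDeltaComp_deltaMeasure : IsDeltaComp (pairsNonzero n) (sinArgDiff j) (deltaMeasure j) where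
  compl_null := deltaMeasure_compl_pairsNonzero
  finite_on_compacts _ hK _ := deltaMeasure_lt_top_of_isCompact hK
  tendsto ρ hρ hρc hρ1 φ hφ hφc _ := by
    simpa only [hρ1, mul_one] using tendsto_integral_sinArgDiff_rescaled hρ hρc hφ hφc

end Limit

/-! ### Uniqueness of the delta measure -/

section Uniqueness

theorem exists_continuous_compactSupport_integral_eq_one (ι : Type*) [Fintype ι] :
    ∃ ρ : (ι → ℝ) → ℝ, Continuous ρ ∧ HasCompactSupport ρ ∧ ∫ t, ρ t = 1 := by
  let b : ContDiffBump (0 : ι → ℝ) := ⟨1, 2, one_pos, one_lt_two⟩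
  exact ⟨b.normed volume, b.continuous_normed, b.hasCompactSupport_normed, b.integral_normed⟩

/-- The measures need not be finite on compact sets that leave Ω, so the Riesz uniqueness theorem is
applied on the locally compact space Ω. Its test functions extend by zero to X. -/
theorem measure_eq_of_integral_eq_of_tsupport_subset {X : Type*} [TopologicalSpace X] [T2Space X]
    [LocallyCompactSpace X] [SecondCountableTopology X] [MeasurableSpace X] [BorelSpace X]
    {Ω : Set X} (hΩ : IsOpen Ω) {μ ν : Measure X} (hμ0 : μ Ωᶜ = 0) (hν0 : ν Ωᶜ = 0)
    (hμ : ∀ K, IsCompact K → K ⊆ Ω → μ K < ⊤) (hν : ∀ K, IsCompact K → K ⊆ Ω → ν K < ⊤)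
    (h : ∀ φ : X → ℝ, Continuous φ → HasCompactSupport φ → tsupport φ ⊆ Ω →
      ∫ y, φ y ∂μ = ∫ y, φ y ∂ν) : μ = ν := by
  have hemb : MeasurableEmbedding ((↑) : Ω → X) := MeasurableEmbedding.subtype_coe hΩ.measurableSet
  have hmap : ∀ {κ : Measure X}, κ Ωᶜ = 0 → (κ.comap ((↑) : Ω → X)).map (↑) = κ := fun {κ} hκ => by
    rw [hemb.map_comap, Subtype.range_coe]
    exact Measure.restrict_eq_self_of_ae_mem
      (measure_eq_zero_iff_ae_notMem.1 hκ |>.mono fun _ => not_not.1)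
  have hfin : ∀ {κ : Measure X}, (∀ K, IsCompact K → K ⊆ Ω → κ K < ⊤) →
      IsFiniteMeasureOnCompacts (κ.comap ((↑) : Ω → X)) := fun {κ} hκ => ⟨fun K hK => by
    rw [hemb.comap_apply]
    exact hκ _ (hK.image continuous_subtype_val) (Subtype.coe_image_subset _ _)⟩
  have : LocallyCompactSpace Ω := hΩ.locallyCompactSpace
  have := hfin hμ
  have := hfin hν
  rw [← hmap hμ0, ← hmap hν0]
  congr 1
  refine Measure.ext_of_integral_eq_on_compactlySupported fun f => ?_
  let φ : X → ℝ := Function.extend (↑) f 0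
  have hφf : ∀ x : Ω, φ x = f x := fun x => Subtype.val_injective.extend_apply f 0 x
  have hsupp : Function.support φ ⊆ (↑) '' tsupport f := by
    intro x hx
    by_cases hxΩ : x ∈ Ω
    · refine ⟨⟨x, hxΩ⟩, subset_tsupport _ ?_, rfl⟩
      rwa [Function.mem_support, ← hφf ⟨x, hxΩ⟩]
    · refine absurd (Function.extend_apply' _ _ _ ?_) hx
      rintro ⟨a, rfl⟩
      exact hxΩ a.2
  have hK : IsCompact ((↑) '' tsupport f : Set X) :=
    f.hasCompactSupport.isCompact.image continuous_subtype_val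
  have htsupp : tsupport φ ⊆ (↑) '' tsupport f := closure_minimal hsupp hK.isClosed
  have hts : tsupport φ ⊆ Ω := htsupp.trans (Subtype.coe_image_subset _ _)
  have hφc : Continuous φ := by
    -- Inside Ω the extension is `f` read through an open embedding; outside, it vanishes near the
    -- point because its closed support lies in Ω.
    refine continuous_iff_continuousAt.2 fun x => ?_
    by_cases hxΩ : x ∈ Ω
    · refine (hΩ.isOpenEmbedding_subtypeVal.continuousAt_iff (x := ⟨x, hxΩ⟩)).1 ?_
      have : φ ∘ ((↑) : Ω → X) = f := funext hφf
      rw [this]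
      exact f.continuous.continuousAt
    · have h0 := notMem_tsupport_iff_eventuallyEq.1 fun hx => hxΩ (hts hx)
      exact (continuousAt_congr h0).2 continuousAt_const
  have key := h φ hφc (HasCompactSupport.of_support_subset_isCompact hK hsupp) hts
  rw [← hmap hμ0, ← hmap hν0, hemb.integral_map, hemb.integral_map] at key
  simpa only [hφf] using key

theorem IsDeltaComp.unique {X ι : Type*} [TopologicalSpace X] [T2Space X]
    [LocallyCompactSpace X] [SecondCountableTopology X] [MeasureSpace X] [BorelSpace X]
    [Fintype ι] {Ω : Set X} (hΩ : IsOpen Ω) {g : X → ι → ℝ} {μ ν : Measure X}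
    (hμ : IsDeltaComp Ω g μ) (hν : IsDeltaComp Ω g ν) : μ = ν := by
  obtain ⟨ρ, hρ, hρc, hρ1⟩ := exists_continuous_compactSupport_integral_eq_one ι
  refine measure_eq_of_integral_eq_of_tsupport_subset hΩ hμ.compl_null hν.compl_null
    hμ.finite_on_compacts hν.finite_on_compacts fun φ hφ hφc hφΩ => ?_
  exact tendsto_nhds_unique (hμ.tendsto ρ hρ hρc hρ1 φ hφ hφc hφΩ)
    (hν.tendsto ρ hρ hρc hρ1 φ hφ hφc hφΩ)

end Uniqueness

/-! ### The normal operator as convolution with a measure -/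

/-- The positive measure by which the normal operator `P* P` acts by convolution: the image of
`|α|⁻ⁿ dα dw` under `(α, w) ↦ ((1 - 1/α) w, w)`. -/
noncomputable def normalMeasure (n : ℕ) : Measure ((Fin n → ℝ) × (Fin n → ℝ)) :=
  ((volume : Measure (ℝ × (Fin n → ℝ))).withDensity
    fun q => ENNReal.ofReal (|q.1| ^ n)⁻¹).map fun q => ((1 - q.1⁻¹) • q.2, q.2)

section NormalMeasure

variable {n : ℕ}

theorem measurable_normalMeasure_density :
    Measurable fun q : ℝ × (Fin n → ℝ) => ENNReal.ofReal (|q.1| ^ n)⁻¹ := by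
  have : Measurable fun q : ℝ × (Fin n → ℝ) => |q.1| :=
    (by fun_prop : Continuous fun q : ℝ × (Fin n → ℝ) => |q.1|).measurable
  fun_prop

theorem measurable_normalMeasure_map :
    Measurable fun q : ℝ × (Fin n → ℝ) => ((1 - q.1⁻¹) • q.2, q.2) := by
  fun_prop

theorem lintegral_normalMeasure {h : (Fin n → ℝ) × (Fin n → ℝ) → ENNReal} (hh : Measurable h) :
    ∫⁻ y, h y ∂normalMeasure n = ∫⁻ α : ℝ, ENNReal.ofReal (|α| ^ n)⁻¹ *
      ∫⁻ w : Fin n → ℝ, h ((1 - α⁻¹) • w, w) := by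
  have hm : Measurable fun q : ℝ × (Fin n → ℝ) =>
      ENNReal.ofReal (|q.1| ^ n)⁻¹ * h ((1 - q.1⁻¹) • q.2, q.2) :=
    measurable_normalMeasure_density.mul (hh.comp measurable_normalMeasure_map)
  rw [normalMeasure, lintegral_map_withDensity measurable_normalMeasure_density
    measurable_normalMeasure_map hh, Measure.volume_eq_prod, lintegral_prod _ hm.aemeasurable]
  refine lintegral_congr fun α => ?_
  have hα : Measurable fun w : Fin n → ℝ => h ((1 - α⁻¹) • w, w) := hh.comp (by fun_prop)
  exact lintegral_const_mul (μ := volume) (ENNReal.ofReal (|α| ^ n)⁻¹) hα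

/-- The substitution u = z₂ - w; the terms in z₂ of the first argument cancel and leave z₁ - (1 -
1/α)w. -/
theorem photographyTransform_eq_integral_sub {V : Type*} [NormedAddCommGroup V] [NormedSpace ℝ V]
    (g : (Fin n → ℝ) × (Fin n → ℝ) → V) (z : (Fin n → ℝ) × (Fin n → ℝ)) {α : ℝ} (hα : α ≠ 0) :
    photographyTransform g α (α • z.1 + (1 - α) • z.2) =
      (|α| ^ n)⁻¹ • ∫ w : Fin n → ℝ, g (z - ((1 - α⁻¹) • w, w)) := by
  rw [photographyTransform, if_neg hα, ← integral_sub_left_eq_self _ volume z.2]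
  congr 2
  funext w
  congr 1
  refine Prod.ext ?_ rfl
  funext i
  simp only [Pi.add_apply, Pi.smul_apply, Pi.sub_apply, smul_eq_mul, Prod.fst_sub]
  field_simp
  ring

theorem SchwartzMap.exists_norm_sub_le {E F : Type*} [NormedAddCommGroup E] [NormedSpace ℝ E]
    [NormedAddCommGroup F] [NormedSpace ℝ F] (f : 𝓢(E, F)) (z : E) (k : ℕ) :
    ∃ C, 0 ≤ C ∧ ∀ y, ‖f (z - y)‖ ≤ C * (1 + ‖y‖) ^ (-(k : ℝ)) := by
  set C := 2 ^ k * (Finset.Iic (k, 0)).sup (fun m => SchwartzMap.seminorm ℝ m.1 m.2) f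
  have hC : 0 ≤ C := mul_nonneg (by positivity) (apply_nonneg _ _)
  refine ⟨(1 + ‖z‖) ^ k * C, by positivity, fun y => ?_⟩
  have h1 := SchwartzMap.one_add_le_sup_seminorm_apply (𝕜 := ℝ) (m := (k, 0)) le_rfl le_rfl f (z - y)
  rw [norm_iteratedFDeriv_zero] at h1
  have h2 : 1 + ‖y‖ ≤ (1 + ‖z‖) * (1 + ‖z - y‖) := by
    have : ‖y‖ ≤ ‖z‖ + ‖z - y‖ := by simpa using norm_sub_le z (z - y)
    nlinarith [norm_nonneg z, norm_nonneg (z - y)]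
  have h3 : (1 + ‖y‖) ^ k ≤ (1 + ‖z‖) ^ k * (1 + ‖z - y‖) ^ k := by
    rw [← mul_pow]
    exact pow_le_pow_left₀ (by positivity) h2 k
  rw [Real.rpow_neg (by positivity), Real.rpow_natCast, ← div_eq_mul_inv,
    le_div_iff₀ (by positivity)]
  calc ‖f (z - y)‖ * (1 + ‖y‖) ^ k
      ≤ ‖f (z - y)‖ * ((1 + ‖z‖) ^ k * (1 + ‖z - y‖) ^ k) := by gcongr
    _ = (1 + ‖z‖) ^ k * ((1 + ‖z - y‖) ^ k * ‖f (z - y)‖) := by ring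
    _ ≤ (1 + ‖z‖) ^ k * C := by gcongr

theorem measurable_enorm_sub (f : 𝓢((Fin n → ℝ) × (Fin n → ℝ), ℂ))
    (z : (Fin n → ℝ) × (Fin n → ℝ)) : Measurable fun y => ‖f (z - y)‖ₑ :=
  (f.continuous.comp (by fun_prop)).enorm.measurable

variable (f : 𝓢((Fin n → ℝ) × (Fin n → ℝ), ℂ)) (z : (Fin n → ℝ) × (Fin n → ℝ))

theorem integrable_one_add_norm_rpow_neg_finrank_succ (n : ℕ) :
    Integrable fun w : Fin n → ℝ => (1 + ‖w‖) ^ (-((n + 1 : ℕ) : ℝ)) :=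
  integrable_one_add_norm (by simp)

theorem integrable_sub_smul_prodMk (β : ℝ) :
    Integrable fun w : Fin n → ℝ => f (z - (β • w, w)) := by
  obtain ⟨C, hC, hf⟩ := f.exists_norm_sub_le z (n + 1)
  refine ((integrable_one_add_norm_rpow_neg_finrank_succ n).const_mul C).mono'
    (f.continuous.comp (by fun_prop)).aestronglyMeasurable (.of_forall fun w => (hf _).trans ?_)
  refine mul_le_mul_of_nonneg_left ?_ hC
  exact Real.rpow_le_rpow_of_nonpos (by positivity)
    (by gcongr; exact norm_snd_le (β • w, w)) (neg_nonpos.2 (Nat.cast_nonneg _))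

theorem lintegral_photographyTransform_norm :
    ∫⁻ α : ℝ, ‖photographyTransform (fun q => ‖f q‖) α (α • z.1 + (1 - α) • z.2)‖ₑ =
      ∫⁻ y, ‖f (z - y)‖ₑ ∂normalMeasure n := by
  rw [lintegral_normalMeasure (measurable_enorm_sub f z)]
  refine lintegral_congr_ae ?_
  filter_upwards [Measure.ae_ne volume (0 : ℝ)] with α hα
  rw [photographyTransform_eq_integral_sub _ _ hα, enorm_smul, Real.enorm_of_nonneg (by positivity),
    Real.enorm_of_nonneg (by positivity),
    ofReal_integral_norm_eq_lintegral_enorm (integrable_sub_smul_prodMk f z _)]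

/-- Fubini. The value of the transform at α = 0 plays no role, being taken on a null set. -/
theorem integral_photographyTransform (h : Integrable (fun y => f (z - y)) (normalMeasure n)) :
    Integrable (fun α : ℝ => photographyTransform f α (α • z.1 + (1 - α) • z.2)) ∧
      dualPhotographyTransform (photographyTransform f) z =
        ∫ y, f (z - y) ∂normalMeasure n := by
  have hlt : ∀ᵐ q : ℝ × (Fin n → ℝ), ENNReal.ofReal (|q.1| ^ n)⁻¹ < ⊤ := by simp
  have hae : (fun α : ℝ => photographyTransform f α (α • z.1 + (1 - α) • z.2)) =ᵐ[volume]
      fun α => ∫ w : Fin n → ℝ, (ENNReal.ofReal (|α| ^ n)⁻¹).toReal •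
        f (z - ((1 - α⁻¹) • w, w)) := by
    filter_upwards [Measure.ae_ne volume (0 : ℝ)] with α hα
    rw [photographyTransform_eq_integral_sub _ _ hα, integral_smul,
      ENNReal.toReal_ofReal (by positivity)]
  have h1 := (integrable_map_measure h.aestronglyMeasurable
    measurable_normalMeasure_map.aemeasurable).1 h
  have h2 := (integrable_withDensity_iff_integrable_smul'
    measurable_normalMeasure_density hlt).1 h1
  rw [Measure.volume_eq_prod] at h2
  refine ⟨h2.integral_prod_left.congr hae.symm, ?_⟩
  rw [dualPhotographyTransform, integral_congr_ae hae, normalMeasure,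
    integral_map measurable_normalMeasure_map.aemeasurable h.aestronglyMeasurable,
    integral_withDensity_eq_integral_toReal_smul measurable_normalMeasure_density hlt,
    Measure.volume_eq_prod]
  exact (integral_prod _ h2).symm

/-- In the sup norm the point ((1 - 1/α)w, w) has norm b‖w‖, so rescaling w produces (|α| b)⁻ⁿ. Here
|α| b = max(|α|, |α - 1|), which is at least (1 + |α|)/3; the singularity at α = 0 disappears. -/
theorem ofReal_inv_pow_mul_lintegral_one_add_norm_le {α : ℝ} (hα : α ≠ 0) (r : ℝ) :
    ENNReal.ofReal (|α| ^ n)⁻¹ * ∫⁻ w : Fin n → ℝ,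
        ENNReal.ofReal ((1 + ‖((1 - α⁻¹) • w, w)‖) ^ (-r)) ≤
      ENNReal.ofReal (3 ^ n * (1 + ‖α‖) ^ (-(n : ℝ))) *
        ∫⁻ w : Fin n → ℝ, ENNReal.ofReal ((1 + ‖w‖) ^ (-r)) := by
  set b := max 1 |1 - α⁻¹|
  have hb : 0 < b := lt_max_of_lt_left one_pos
  have hα' := abs_pos.2 hα
  have hnorm : ∀ w : Fin n → ℝ, ‖((1 - α⁻¹) • w, w)‖ = ‖b • w‖ := fun w => by
    rw [Prod.norm_def, norm_smul, norm_smul, Real.norm_eq_abs, Real.norm_of_nonneg hb.le,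
      max_mul_of_nonneg _ _ (norm_nonneg w), one_mul, max_comm]
  have hαb : (1 + |α|) / 3 ≤ |α| * b := by
    rw [mul_max_of_nonneg _ _ hα'.le, mul_one, ← abs_mul, mul_sub, mul_one, mul_inv_cancel₀ hα]
    rcases le_total (1 / 2) |α| with h | h
    · exact le_max_of_le_left (by linarith)
    · refine le_max_of_le_right ?_
      have := abs_sub_abs_le_abs_sub 1 α
      rw [abs_one, abs_sub_comm] at this
      linarith
  simp only [hnorm]
  have hscale : ∫⁻ w : Fin n → ℝ, ENNReal.ofReal ((1 + ‖w‖) ^ (-r)) = ENNReal.ofReal (b ^ n) *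
      ∫⁻ w : Fin n → ℝ, ENNReal.ofReal ((1 + ‖b • w‖) ^ (-r)) := by
    have := lintegral_eq_prod_mul_lintegral_mul (d := fun _ : Fin n => b) (fun _ => hb.ne')
      (H := fun w => ENNReal.ofReal ((1 + ‖w‖) ^ (-r))) (by fun_prop)
    rw [Finset.prod_const, Finset.card_univ, Fintype.card_fin, abs_of_pos hb] at this
    exact this
  rw [hscale, ← mul_assoc, ← ENNReal.ofReal_mul (by positivity)]
  gcongr
  rw [Real.rpow_neg (by positivity), Real.rpow_natCast, ← div_eq_mul_inv, div_mul_eq_mul_div,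
    ← mul_pow, ← div_pow, Real.norm_eq_abs, ← inv_pow]
  refine pow_le_pow_left₀ (by positivity) ?_ n
  rw [inv_le_iff_one_le_mul₀ hα', div_mul_eq_mul_div, le_div_iff₀ (by positivity)]
  linarith

/-- Schwartz decay of order n + 1 suffices for the integral over w ∈ ℝⁿ. The hypothesis n ≥ 2 is
what makes (1 + |α|)⁻ⁿ integrable on ℝ. -/
theorem integrable_sub_normalMeasure (hn : 2 ≤ n) :
    Integrable (fun y => f (z - y)) (normalMeasure n) := by
  obtain ⟨C, hC, hf⟩ := f.exists_norm_sub_le z (n + 1)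
  refine ⟨(f.continuous.comp (by fun_prop)).aestronglyMeasurable, ?_⟩
  have hmeas : Measurable fun y : (Fin n → ℝ) × (Fin n → ℝ) =>
      ENNReal.ofReal ((1 + ‖y‖) ^ (-((n + 1 : ℕ) : ℝ))) := by fun_prop
  calc ∫⁻ y, ‖f (z - y)‖ₑ ∂normalMeasure n
      ≤ ∫⁻ y, ENNReal.ofReal C * ENNReal.ofReal ((1 + ‖y‖) ^ (-((n + 1 : ℕ) : ℝ)))
          ∂normalMeasure n := by
        refine lintegral_mono fun y => ?_
        rw [← ENNReal.ofReal_mul hC, ← ofReal_norm]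
        exact ENNReal.ofReal_le_ofReal (hf y)
    _ = ENNReal.ofReal C * ∫⁻ α : ℝ, ENNReal.ofReal (|α| ^ n)⁻¹ * ∫⁻ w : Fin n → ℝ,
          ENNReal.ofReal ((1 + ‖((1 - α⁻¹) • w, w)‖) ^ (-((n + 1 : ℕ) : ℝ))) := by
        rw [lintegral_const_mul _ hmeas, lintegral_normalMeasure hmeas]
    _ ≤ ENNReal.ofReal C * ∫⁻ α : ℝ, ENNReal.ofReal (3 ^ n * (1 + ‖α‖) ^ (-(n : ℝ))) *
          ∫⁻ w : Fin n → ℝ, ENNReal.ofReal ((1 + ‖w‖) ^ (-((n + 1 : ℕ) : ℝ))) := by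
        refine mul_le_mul_right (lintegral_mono_ae ?_) _
        filter_upwards [Measure.ae_ne volume (0 : ℝ)] with α hα
        exact ofReal_inv_pow_mul_lintegral_one_add_norm_le hα _
    _ < ⊤ := by
        have h1 : ∫⁻ w : Fin n → ℝ, ENNReal.ofReal ((1 + ‖w‖) ^ (-((n + 1 : ℕ) : ℝ))) < ⊤ :=
          (integrable_one_add_norm_rpow_neg_finrank_succ n).lintegral_lt_top
        have h2 : ∫⁻ α : ℝ, ENNReal.ofReal (3 ^ n * (1 + ‖α‖) ^ (-(n : ℝ))) < ⊤ :=
          ((integrable_one_add_norm (by simp; linarith)).const_mul _).lintegral_lt_top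
        rw [lintegral_mul_const _ (by fun_prop)]
        exact ENNReal.mul_lt_top ENNReal.ofReal_lt_top (ENNReal.mul_lt_top h2 h1)

end NormalMeasure

/-! ### From the measure to a kernel -/

section Kernel

variable {n : ℕ} {μ : Measure ((Fin n → ℝ) × (Fin n → ℝ))} {K : (Fin n → ℝ) × (Fin n → ℝ) → ℝ}

/-- Once the density `K` times `μ` is known to be `normalMeasure`, all the assertions on the
operator follow from the previous part. It serves both the general case and n = 1. -/
theorem normal_operator_eq_convolution (hK : Measurable K) (hK0 : ∀ y, 0 ≤ K y)
    (hμ : μ.withDensity (fun y => ENNReal.ofReal (K y)) = normalMeasure n)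
    (f : 𝓢((Fin n → ℝ) × (Fin n → ℝ), ℂ)) (z : (Fin n → ℝ) × (Fin n → ℝ)) :
    (∫⁻ α : ℝ, ‖photographyTransform (fun q => ‖f q‖) α (α • z.1 + (1 - α) • z.2)‖ₑ =
      ∫⁻ y, ‖K y • f (z - y)‖ₑ ∂μ) ∧
    (ConvolutionExistsAt K f z (ContinuousLinearMap.lsmul ℝ ℝ) μ →
      Integrable (fun α : ℝ => photographyTransform f α (α • z.1 + (1 - α) • z.2)) ∧
      dualPhotographyTransform (photographyTransform f) z =
        (K ⋆[ContinuousLinearMap.lsmul ℝ ℝ, μ] f) z) ∧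
    (2 ≤ n → ConvolutionExistsAt K f z (ContinuousLinearMap.lsmul ℝ ℝ) μ) := by
  have hm : Measurable fun y => ENNReal.ofReal (K y) := hK.ennreal_ofReal
  have hlt : ∀ᵐ y ∂μ, ENNReal.ofReal (K y) < ⊤ := by simp
  have hiff : Integrable (fun y => f (z - y)) (normalMeasure n) ↔
      ConvolutionExistsAt K f z (ContinuousLinearMap.lsmul ℝ ℝ) μ := by
    rw [← hμ, integrable_withDensity_iff_integrable_smul' hm hlt]
    simp only [ENNReal.toReal_ofReal (hK0 _)]
    rfl
  refine ⟨?_, fun h => ?_, fun hn => hiff.1 (integrable_sub_normalMeasure f z hn)⟩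
  · rw [lintegral_photographyTransform_norm, ← hμ, lintegral_withDensity_eq_lintegral_mul _ hm
      (measurable_enorm_sub f z)]
    refine lintegral_congr fun y => ?_
    rw [enorm_smul, Real.enorm_of_nonneg (hK0 y), Pi.mul_apply]
  · obtain ⟨h1, h2⟩ := integral_photographyTransform f z (hiff.2 h)
    refine ⟨h1, h2.trans ?_⟩
    rw [← hμ, integral_withDensity_eq_integral_toReal_smul hm hlt, convolution_def]
    simp only [ENNReal.toReal_ofReal (hK0 _)]
    rfl

end Kernel

/-! ### Identification of the kernel -/

/-- The point whose `j`-th pair of coordinates is `p` and whose `i`-th pair is `τᵢ p` for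
`i ≠ j`. -/
def coneFrame {n : ℕ} (j : Fin n) (p : ℝ × ℝ) (τ : {i : Fin n // i ≠ j} → ℝ) :
    (Fin n → ℝ) × (Fin n → ℝ) :=
  (insertAt j p.1 fun i => p.1 * τ i, insertAt j p.2 fun i => p.2 * τ i)

section Kernel

variable {n : ℕ} {j : Fin n}

theorem measurable_coneFrame : Measurable
    fun w : (ℝ × ℝ) × ({i : Fin n // i ≠ j} → ℝ) => coneFrame j w.1 w.2 := by
  unfold coneFrame
  fun_prop

theorem pairFrame_planeNorm_mul {p : ℝ × ℝ} (hp : p ≠ 0) (τ : {i : Fin n // i ≠ j} → ℝ) :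
    pairFrame j p (fun i => planeNorm p * τ i) 0 = coneFrame j p τ := by
  have h0 := (planeNorm_pos hp).ne'
  unfold pairFrame coneFrame planeReflection
  congr 2 <;> funext i <;> simp only [Pi.zero_apply] <;> field_simp <;> ring

theorem smul_insertAt_mul (β b : ℝ) (τ : {i : Fin n // i ≠ j} → ℝ) :
    (β • insertAt j b (fun i => b * τ i), insertAt j b fun i => b * τ i) =
      coneFrame j (β * b, b) τ := by
  refine Prod.ext ?_ rfl
  refine (apply_insertAt (fun x => β * x) b fun i => b * τ i).trans ?_
  simp only [coneFrame, mul_assoc]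

theorem card_ne (j : Fin n) : Fintype.card {i : Fin n // i ≠ j} = n - 1 := by
  simp [Fintype.card_subtype_compl]

theorem measurable_kernelWeight : Measurable (kernelWeight j) := by
  have h1 : Measurable fun y : (Fin n → ℝ) × (Fin n → ℝ) => |y.1 j - y.2 j| :=
    (by fun_prop : Continuous fun y : (Fin n → ℝ) × (Fin n → ℝ) => |y.1 j - y.2 j|).measurable
  have h2 : ∀ i, Measurable fun y : (Fin n → ℝ) × (Fin n → ℝ) => pairNorm y i := fun i => by
    unfold pairNorm; fun_prop
  have h3 : Measurable fun x : ℝ => x ^ ((n : ℤ) - 2) := by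
    fun_prop
  unfold kernelWeight
  exact (h3.comp h1).div (((h2 j).pow_const _).mul
    (Finset.measurable_fun_prod _ fun i _ => h2 i))

theorem kernelWeight_nonneg (y : (Fin n → ℝ) × (Fin n → ℝ)) : 0 ≤ kernelWeight j y := by
  have h : ∀ i, 0 ≤ pairNorm y i := fun i => Real.sqrt_nonneg _
  have h' : 0 ≤ ∏ i ∈ Finset.univ.erase j, pairNorm y i := Finset.prod_nonneg fun i _ => h i
  have := h j
  unfold kernelWeight
  positivity

theorem kernelWeight_pairFrame_zero {p : ℝ × ℝ} (hp : p ≠ 0) (t : {i : Fin n // i ≠ j} → ℝ) :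
    kernelWeight j (pairFrame j p t 0) =
      |p.1 - p.2| ^ ((n : ℤ) - 2) / (planeNorm p ^ (n - 1) * ∏ i, |t i|) := by
  have hprod := Finset.prod_subtype (p := fun i => i ≠ j) (F := inferInstance)
    (Finset.univ.erase j) (by simp) (pairNorm (pairFrame j p t 0))
  rw [kernelWeight, pairNorm_pairFrame_self, hprod]
  simp only [pairNorm_pairFrame_val hp]
  simp [pairFrame, Real.sqrt_sq_eq_abs]

/-- The density ∏|tᵢ| cancels the norms of the pairs i ≠ j, and the Jacobian ‖p‖^{n-1} of t = ‖p‖τ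
cancels the power of the norm of the j-th pair. -/
theorem lintegral_kernelWeight_deltaMeasure {h : (Fin n → ℝ) × (Fin n → ℝ) → ENNReal}
    (hh : Measurable h) :
    ∫⁻ y, h y ∂(deltaMeasure j).withDensity (fun y => ENNReal.ofReal (kernelWeight j y)) =
      ∫⁻ p : ℝ × ℝ, ENNReal.ofReal (|p.1 - p.2| ^ ((n : ℤ) - 2)) *
        ∫⁻ τ : {i : Fin n // i ≠ j} → ℝ, h (coneFrame j p τ) := by
  have hk : Measurable fun y => ENNReal.ofReal (kernelWeight j y) :=
    measurable_kernelWeight.ennreal_ofReal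
  have hm : Measurable fun w : (ℝ × ℝ) × ({i : Fin n // i ≠ j} → ℝ) =>
      ENNReal.ofReal (∏ i, |w.2 i|) * (ENNReal.ofReal (kernelWeight j (pairFrame j w.1 w.2 0)) *
        h (pairFrame j w.1 w.2 0)) :=
    measurable_prod_abs_snd.mul ((hk.mul hh).comp measurable_pairFrame_zero)
  rw [lintegral_withDensity_eq_lintegral_mul _ hk hh, lintegral_deltaMeasure (hk.mul hh)]
  simp only [Pi.mul_apply]
  rw [Measure.volume_eq_prod (ℝ × ℝ), lintegral_prod _ hm.aemeasurable]
  refine lintegral_congr_ae ?_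
  filter_upwards [Measure.ae_ne volume (0 : ℝ × ℝ)] with p hp
  have h0 := planeNorm_pos hp
  have hpf : Measurable fun t : {i : Fin n // i ≠ j} → ℝ => h (pairFrame j p t 0) :=
    hh.comp (measurable_pairFrame_zero.comp (f := fun t => (p, t)) (by fun_prop))
  have hcone : Measurable fun τ : {i : Fin n // i ≠ j} → ℝ => h (coneFrame j p τ) :=
    hh.comp (measurable_coneFrame.comp (f := fun t => (p, t)) (by fun_prop))
  calc _ = ∫⁻ t : {i : Fin n // i ≠ j} → ℝ, ENNReal.ofReal
            (|p.1 - p.2| ^ ((n : ℤ) - 2) / planeNorm p ^ (n - 1)) * h (pairFrame j p t 0) := by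
        refine lintegral_congr_ae ?_
        have hae : ∀ᵐ t : {i : Fin n // i ≠ j} → ℝ, ∀ i, t i ≠ 0 := ae_all_iff.2 fun i =>
          Measure.ae_eval_ne (μ := fun _ : {i : Fin n // i ≠ j} => (volume : Measure ℝ)) i 0
        filter_upwards [hae] with t ht
        have ht' : ∏ i, |t i| ≠ 0 := Finset.prod_ne_zero_iff.2 fun i _ => abs_ne_zero.2 (ht i)
        rw [← mul_assoc, ← ENNReal.ofReal_mul (by positivity), kernelWeight_pairFrame_zero hp]
        congr 2
        field_simp
    _ = _ := by
        rw [lintegral_const_mul _ hpf,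
          lintegral_eq_prod_mul_lintegral_mul (d := fun _ => planeNorm p) (fun _ => h0.ne') hpf,
          ← mul_assoc, ← ENNReal.ofReal_mul (by positivity)]
        simp only [pairFrame_planeNorm_mul hp, Finset.prod_const, Finset.card_univ, card_ne,
          abs_of_pos h0]
        rw [div_mul_cancel₀ _ (by positivity)]

/-- The substitution a = (1 - 1/α)b is a bijection from α ≠ 0 onto a ≠ b with derivative b/α²; the
missing points are null. -/
theorem lintegral_eq_lintegral_one_sub_inv_mul {b : ℝ} (hb : b ≠ 0) (g : ℝ → ENNReal) :
    ∫⁻ a, g a = ∫⁻ α, ENNReal.ofReal (|b| / α ^ 2) * g ((1 - α⁻¹) * b) := by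
  have himage : (fun α : ℝ => (1 - α⁻¹) * b) '' {0}ᶜ = {b}ᶜ := by
    ext a
    simp only [Set.mem_image, Set.mem_compl_iff, Set.mem_singleton_iff]
    constructor
    · rintro ⟨α, hα, rfl⟩ h
      have := inv_ne_zero hα
      apply this
      have h' : α⁻¹ * b = 0 := by linarith
      exact (mul_eq_zero.1 h').resolve_right hb
    · intro ha
      have hab : b - a ≠ 0 := sub_ne_zero.2 (Ne.symm ha)
      refine ⟨b / (b - a), div_ne_zero hb hab, ?_⟩
      field_simp
      ring
  have hinj : Set.InjOn (fun α : ℝ => (1 - α⁻¹) * b) {0}ᶜ := by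
    intro x _ y _ h
    have := mul_right_cancel₀ hb h
    exact inv_injective (by linarith)
  have hderiv : ∀ α ∈ ({0}ᶜ : Set ℝ),
      HasDerivWithinAt (fun α : ℝ => (1 - α⁻¹) * b) (b / α ^ 2) {0}ᶜ α := by
    intro α hα
    have h1 := ((hasDerivAt_inv (show α ≠ 0 from hα)).const_sub 1).mul_const b
    exact h1.hasDerivWithinAt.congr_deriv (by rw [neg_neg, inv_mul_eq_div])
  have key := lintegral_image_eq_lintegral_abs_deriv_mul
    (measurableSet_singleton (0 : ℝ)).compl hderiv hinj g
  rw [himage, restrict_compl_singleton, restrict_compl_singleton] at key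
  rw [key]
  simp only [abs_div, abs_pow, sq_abs]

/-- From a - b = -b/α with a = (1 - 1/α)b. The integer exponent n - 2 is -1 when n = 1. -/
theorem abs_div_sq_mul_zpow {α b : ℝ} (hα : α ≠ 0) (hb : b ≠ 0) (hn : 1 ≤ n) :
    |b| / α ^ 2 * |(1 - α⁻¹) * b - b| ^ ((n : ℤ) - 2) = (|α| ^ n)⁻¹ * |b| ^ (n - 1) := by
  obtain ⟨m, rfl⟩ := Nat.exists_eq_add_of_le' hn
  have hα' := abs_ne_zero.2 hα
  have hb' := abs_ne_zero.2 hb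
  have h1 : |(1 - α⁻¹) * b - b| = |b| / |α| := by
    rw [show (1 - α⁻¹) * b - b = -(b / α) by field_simp; ring, abs_neg, abs_div]
  rw [h1, ← sq_abs α, show ((m + 1 : ℕ) : ℤ) - 2 = (m : ℤ) - 1 by push_cast; ring,
    zpow_sub_one₀ (by positivity), zpow_natCast, Nat.add_sub_cancel, div_pow]
  field_simp
  ring

/-- Scaling wᵢ = bτᵢ for fixed b = wⱼ gives |b|^{n-1}; after exchanging the integrals in α and b,
the substitution in α makes (a, b) the j-th pair. -/
theorem lintegral_normalMeasure_eq_coneFrame (j : Fin n)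
    {h : (Fin n → ℝ) × (Fin n → ℝ) → ENNReal} (hh : Measurable h) :
    ∫⁻ y, h y ∂normalMeasure n = ∫⁻ p : ℝ × ℝ, ENNReal.ofReal (|p.1 - p.2| ^ ((n : ℤ) - 2)) *
        ∫⁻ τ : {i : Fin n // i ≠ j} → ℝ, h (coneFrame j p τ) := by
  have hn : 1 ≤ n := Nat.one_le_iff_ne_zero.2 fun h => (h ▸ j).elim0
  set G : ℝ × ℝ → ENNReal := fun p => ∫⁻ τ : {i : Fin n // i ≠ j} → ℝ, h (coneFrame j p τ)
  have hG : Measurable G := (hh.comp measurable_coneFrame).lintegral_prod_right'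
  have hzpow : Measurable fun x : ℝ => x ^ ((n : ℤ) - 2) := by fun_prop
  have habs : Measurable fun p : ℝ × ℝ => |p.1 - p.2| :=
    (by fun_prop : Continuous fun p : ℝ × ℝ => |p.1 - p.2|).measurable
  have hmT : Measurable fun p : ℝ × ℝ => ENNReal.ofReal (|p.1 - p.2| ^ ((n : ℤ) - 2)) * G p :=
    (hzpow.comp habs).ennreal_ofReal.mul hG
  have hw : ∀ α : ℝ, ∫⁻ w : Fin n → ℝ, h ((1 - α⁻¹) • w, w) =
      ∫⁻ b : ℝ, ENNReal.ofReal (|b| ^ (n - 1)) * G ((1 - α⁻¹) * b, b) := fun α => by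
    have hH : Measurable fun w : Fin n → ℝ => h ((1 - α⁻¹) • w, w) := hh.comp (by fun_prop)
    have hH' : Measurable fun q : ℝ × ({i : Fin n // i ≠ j} → ℝ) =>
        h ((1 - α⁻¹) • insertAt j q.1 q.2, insertAt j q.1 q.2) :=
      hH.comp (measurePreserving_insertAt (j := j)).measurable
    rw [← (measurePreserving_insertAt (j := j)).lintegral_comp hH, Measure.volume_eq_prod ℝ,
      lintegral_prod _ hH'.aemeasurable]
    refine lintegral_congr_ae ?_
    filter_upwards [Measure.ae_ne volume (0 : ℝ)] with b hb
    rw [lintegral_eq_prod_mul_lintegral_mul (d := fun _ => b) (fun _ => hb)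
      (H := fun t => h ((1 - α⁻¹) • insertAt j b t, insertAt j b t))
      (hH'.comp measurable_prodMk_left)]
    simp only [smul_insertAt_mul, Finset.prod_const, Finset.card_univ, card_ne]
    rfl
  have hm : Measurable fun q : ℝ × ℝ => ENNReal.ofReal (|q.1| ^ n)⁻¹ *
      (ENNReal.ofReal (|q.2| ^ (n - 1)) * G ((1 - q.1⁻¹) * q.2, q.2)) := by
    have h1 : Measurable fun q : ℝ × ℝ => |q.1| :=
      (by fun_prop : Continuous fun q : ℝ × ℝ => |q.1|).measurable
    have h2 : Measurable fun q : ℝ × ℝ => |q.2| :=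
      (by fun_prop : Continuous fun q : ℝ × ℝ => |q.2|).measurable
    exact (h1.pow_const n).inv.ennreal_ofReal.mul
      ((h2.pow_const _).ennreal_ofReal.mul (hG.comp (by fun_prop)))
  calc ∫⁻ y, h y ∂normalMeasure n
      = ∫⁻ α : ℝ, ∫⁻ b : ℝ, ENNReal.ofReal (|α| ^ n)⁻¹ *
          (ENNReal.ofReal (|b| ^ (n - 1)) * G ((1 - α⁻¹) * b, b)) := by
        rw [lintegral_normalMeasure hh]
        refine lintegral_congr fun α => ?_
        rw [hw, lintegral_const_mul' _ _ ENNReal.ofReal_ne_top]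
    _ = ∫⁻ b : ℝ, ∫⁻ α : ℝ, ENNReal.ofReal (|α| ^ n)⁻¹ *
          (ENNReal.ofReal (|b| ^ (n - 1)) * G ((1 - α⁻¹) * b, b)) :=
        lintegral_lintegral_swap hm.aemeasurable
    _ = ∫⁻ b : ℝ, ∫⁻ a : ℝ, ENNReal.ofReal (|a - b| ^ ((n : ℤ) - 2)) * G (a, b) := by
        refine lintegral_congr_ae ?_
        filter_upwards [Measure.ae_ne volume (0 : ℝ)] with b hb
        rw [lintegral_eq_lintegral_one_sub_inv_mul hb fun a =>
          ENNReal.ofReal (|a - b| ^ ((n : ℤ) - 2)) * G (a, b)]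
        refine lintegral_congr_ae ?_
        filter_upwards [Measure.ae_ne volume (0 : ℝ)] with α hα
        rw [← mul_assoc, ← mul_assoc, ← ENNReal.ofReal_mul (by positivity),
          ← ENNReal.ofReal_mul (by positivity), abs_div_sq_mul_zpow hα hb hn]
    _ = _ := by
        rw [Measure.volume_eq_prod ℝ, lintegral_prod_symm _ hmT.aemeasurable]

theorem withDensity_kernelWeight_deltaMeasure (j : Fin n) :
    (deltaMeasure j).withDensity (fun y => ENNReal.ofReal (kernelWeight j y)) =
      normalMeasure n :=
  Measure.ext_of_lintegral _ fun _ hh =>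
    (lintegral_kernelWeight_deltaMeasure hh).trans (lintegral_normalMeasure_eq_coneFrame j hh).symm

/-- There are no other pairs: the product is empty, t and s range over a one-point space, and the
frame map preserves Lebesgue measure. -/
theorem deltaMeasure_eq_volume (j : Fin 1) : deltaMeasure j = volume := by
  have : IsEmpty {i : Fin 1 // i ≠ j} := ⟨fun i => i.2 (Subsingleton.elim _ _)⟩
  refine Measure.ext_of_lintegral _ fun h hh => ?_
  have hm : Measurable fun w : ((ℝ × ℝ) × ({i : Fin 1 // i ≠ j} → ℝ)) ×
      ({i : Fin 1 // i ≠ j} → ℝ) => h (pairFrame j w.1.1 w.1.2 w.2) := hh.comp measurable_pairFrame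
  rw [lintegral_deltaMeasure hh, ← (measurePreserving_pairFrame (j := j)).lintegral_comp hh,
    Measure.volume_eq_prod ((ℝ × ℝ) × ({i : Fin 1 // i ≠ j} → ℝ)),
    lintegral_prod _ hm.aemeasurable]
  refine lintegral_congr fun w => ?_
  simp only [Finset.univ_eq_empty, Finset.prod_empty, ENNReal.ofReal_one, one_mul]
  rw [lintegral_unique, volume_pi, Measure.pi_of_empty]
  simp only [measure_univ, mul_one]
  congr 2
  exact Subsingleton.elim _ _

theorem kernelWeight_fin_one (y : (Fin 1 → ℝ) × (Fin 1 → ℝ)) :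
    kernelWeight 0 y = |y.1 0 - y.2 0|⁻¹ := by
  simp [kernelWeight]

end Kernel

theorem theorem3p8 :
    (∀ (n : ℕ) (j : Fin n),
      ∃ δ : Measure ((Fin n → ℝ) × (Fin n → ℝ)),
        -- `δ` is the measure `∏_{i ≠ j} δ(sin(φⱼ - φᵢ))`, and it is the only one
        IsDeltaComp (pairsNonzero n) (sinArgDiff j) δ ∧
        (∀ δ', IsDeltaComp (pairsNonzero n) (sinArgDiff j) δ' → δ' = δ) ∧
        ∀ (f : 𝓢((Fin n → ℝ) × (Fin n → ℝ), ℂ)) (z : (Fin n → ℝ) × (Fin n → ℝ)),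
          -- the identity for `|f|`, between values in `[0, ∞]`
          (∫⁻ α : ℝ, ‖photographyTransform (fun q => ‖f q‖) α (α • z.1 + (1 - α) • z.2)‖ₑ
            = ∫⁻ y, ‖kernelWeight j y • f (z - y)‖ₑ ∂δ) ∧
          -- the identity for `f`, where the convolution converges absolutely
          (ConvolutionExistsAt (kernelWeight j) f z (ContinuousLinearMap.lsmul ℝ ℝ) δ →
            Integrable (fun α : ℝ => photographyTransform f α (α • z.1 + (1 - α) • z.2)) ∧
            dualPhotographyTransform (photographyTransform f) z
              = (kernelWeight j ⋆[ContinuousLinearMap.lsmul ℝ ℝ, δ] f) z) ∧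
          -- which is everywhere if `n ≥ 2`
          (2 ≤ n →
            ConvolutionExistsAt (kernelWeight j) f z (ContinuousLinearMap.lsmul ℝ ℝ) δ)) ∧
    -- the case `n = 1`
    (∀ (f : 𝓢((Fin 1 → ℝ) × (Fin 1 → ℝ), ℂ)) (z : (Fin 1 → ℝ) × (Fin 1 → ℝ)),
      (∫⁻ α : ℝ, ‖photographyTransform (fun q => ‖f q‖) α (α • z.1 + (1 - α) • z.2)‖ₑ
        = ∫⁻ y : (Fin 1 → ℝ) × (Fin 1 → ℝ), ‖|y.1 0 - y.2 0|⁻¹ • f (z - y)‖ₑ) ∧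
      (ConvolutionExistsAt (fun y : (Fin 1 → ℝ) × (Fin 1 → ℝ) => |y.1 0 - y.2 0|⁻¹) f z
          (ContinuousLinearMap.lsmul ℝ ℝ) volume →
        Integrable (fun α : ℝ => photographyTransform f α (α • z.1 + (1 - α) • z.2)) ∧
        dualPhotographyTransform (photographyTransform f) z
          = ((fun y : (Fin 1 → ℝ) × (Fin 1 → ℝ) => |y.1 0 - y.2 0|⁻¹)
              ⋆[ContinuousLinearMap.lsmul ℝ ℝ, volume] f) z)) := by
  refine ⟨fun n j => ⟨deltaMeasure j, isDeltaComp_deltaMeasure,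
    fun δ' hδ' => hδ'.unique (isOpen_pairsNonzero n) isDeltaComp_deltaMeasure,
    normal_operator_eq_convolution measurable_kernelWeight kernelWeight_nonneg
      (withDensity_kernelWeight_deltaMeasure j)⟩, fun f z => ?_⟩
  have hK : kernelWeight (0 : Fin 1) = fun y => |y.1 0 - y.2 0|⁻¹ := funext kernelWeight_fin_one
  have h := normal_operator_eq_convolution measurable_kernelWeight kernelWeight_nonneg
    (withDensity_kernelWeight_deltaMeasure (0 : Fin 1)) f z
  rw [deltaMeasure_eq_volume, hK] at h
  exact ⟨h.1, h.2.1⟩
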